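/- Let $(i,j)\in\{(2,3),(2,5),(3,4),(3,5)\}$, let $I\subset\mathbb R$ be an interval, let $t_0$ be an interior point of $I$, and let $\gamma=(x,z):I\to\mathbb R^2$ be a $C^\infty$ curve with $x(t_0)>0$. Let $$\boldsymbol z(t,\theta)=(x(t)\cos\theta,\;x(t)\sin\theta,\;z(t))$$ be the surface of revolution of $\gamma$ around the $z$-axis, where $(t,\theta)\in I\times\mathbb R$. Two $C^\infty$ map-germs $f:(\mathbb R^m,p)\to(\mathbb R^n,f(p))$ and $g:(\mathbb R^m,p')\to(\mathbb R^n,g(p'))$ are called $\mathcal A$-equivalent if there are germs of $C^\infty$ diffeomorphisms $\phi:(\mathbb R^m,p)\to(\mathbb R^m,p')$ and $\Phi:(\mathbb R^n,f(p))\to(\mathbb R^n,g(p'))$ with $g=\Phi\circ f\circ\phi^{-1}$ as germs at $p'$. The curve $\gamma$ at $t_0$ is called a $j/i$-cusp if its germ at $t_0$ is $\mathcal A$-equivalent to the germ of $t\mapsto(t^i,t^j)$ at $0$. A map $f$ from a neighbourhood of $p\in\mathbb R^2$ to $\mathbb R^3$ is called a $j/i$-cuspidal edge at $p$ if its germ at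 $p$ is $\mathcal A$-equivalent to the germ of $(u,v)\mapsto(u,v^i,v^j)$ at $(0,0)$. Then, for every $\theta_0\in\mathbb R$, the curve $\gamma$ at $t_0$ is a $j/i$-cusp if and only if $\boldsymbol z$ at $(t_0,\theta_0)$ is a $j/i$-cuspidal edge. -/

import Mathlib

open scoped Manifold ContDiff Topology

section MapGerms

variable {E F E' F' : Type*}
  [NormedAddCommGroup E] [NormedSpace ℝ E] [NormedAddCommGroup F] [NormedSpace ℝ F]
  [NormedAddCommGroup E'] [NormedSpace ℝ E'] [NormedAddCommGroup F'] [NormedSpace ℝ F']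

/-- `φ` represents the germ of a smooth diffeomorphism `(E, p) → (F, q)`. -/
def IsDiffeoGerm (φ : E → F) (p : E) (q : F) : Prop :=
  IsLocalDiffeomorphAt 𝓘(ℝ, E) 𝓘(ℝ, F) ∞ φ p ∧ φ p = q

/-- The germs `f : (E, p) → (F, f p)` and `g : (E', p') → (F', g p')` are `𝒜`-equivalent
(right-left equivalent): there are diffeomorphism germs `φ : (E, p) → (E', p')` and
`Φ : (F, f p) → (F', g p')` with `Φ ∘ f = g ∘ φ` near `p`, i.e. `g = Φ ∘ f ∘ φ⁻¹` as germs. -/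
def AEquivalentAt (f : E → F) (p : E) (g : E' → F') (p' : E') : Prop :=
  ∃ (φ : E → E') (Φ : F → F'),
    IsDiffeoGerm φ p p' ∧ IsDiffeoGerm Φ (f p) (g p') ∧ Φ ∘ f =ᶠ[𝓝 p] g ∘ φ

end MapGerms

/-- The plane curve `γ` at `t₀` is a `j/i`-cusp: its germ at `t₀` is `𝒜`-equivalent to the germ of
`t ↦ (t ^ i, t ^ j)` at the origin. -/
def IsCuspAt (i j : ℕ) (γ : ℝ → ℝ × ℝ) (t₀ : ℝ) : Prop :=
  AEquivalentAt γ t₀ (fun t : ℝ => (t ^ i, t ^ j)) 0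

/-- The map `f` at `p` is a `j/i`-cuspidal edge: its germ at `p` is `𝒜`-equivalent to the germ of
`(u, v) ↦ (u, v ^ i, v ^ j)` at the origin. -/
def IsCuspidalEdgeAt (i j : ℕ) (f : ℝ × ℝ → ℝ × ℝ × ℝ) (p : ℝ × ℝ) : Prop :=
  AEquivalentAt f p (fun q : ℝ × ℝ => (q.1, q.2 ^ i, q.2 ^ j)) (0, 0)

/-- The surface of revolution of `γ = (x, z)` around the `z`-axis,
`(t, θ) ↦ (x t * cos θ, x t * sin θ, z t)`. -/
noncomputable def surfaceOfRevolutionZ (γ : ℝ → ℝ × ℝ) (q : ℝ × ℝ) : ℝ × ℝ × ℝ :=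
  ((γ q.1).1 * Real.cos q.2, (γ q.1).1 * Real.sin q.2, (γ q.1).2)

/-! In cylindrical coordinates, a local diffeomorphism off the axis, the surface is the trivial
suspension (t, θ) ↦ (θ, γ t), so only the suspension matters. Suspending the equivalences of a cusp
gives those of an edge. Conversely, as i, j ≥ 2, the edge has rank one at the origin with image the
u-axis. Comparing derivatives, the target diffeomorphism sends the θ-axis to the u-axis and the
source one sends the t-axis to the v-axis. Restricting both to the slice θ = θ₀ and dropping the
u-coordinate thus leaves diffeomorphism germs, which identify γ with the cusp. -/

section DiffeoGerms

variable {E F G : Type*}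
  [NormedAddCommGroup E] [NormedSpace ℝ E] [NormedAddCommGroup F] [NormedSpace ℝ F]
  [NormedAddCommGroup G] [NormedSpace ℝ G]

/-- A form of the inverse function theorem: a map that is smooth near `a` and whose derivative at
`a` is invertible is a local diffeomorphism at `a`. -/
theorem isDiffeoGerm_of_hasFDerivAt_equiv [CompleteSpace E] {f : E → F} {a : E} {U : Set E}
    (hU : U ∈ 𝓝 a) (hf : ContDiffOn ℝ ∞ f U) {f' : E ≃L[ℝ] F}
    (hf' : HasFDerivAt f (f' : E →L[ℝ] F) a) : IsDiffeoGerm f a (f a) := by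
  refine ⟨?_, rfl⟩
  have hfa : ContDiffAt ℝ ∞ f a := hf.contDiffAt hU
  set e := hfa.toOpenPartialHomeomorph f hf' (by simp) with he
  have hea : a ∈ e.source := hfa.mem_toOpenPartialHomeomorph_source hf' (by simp)
  have hcont : ContinuousAt (fderiv ℝ f) a :=
    (hfa.fderiv_right (m := 0) (by simp)).continuousAt
  -- Smoothness of the inverse is needed on a whole open set, so the domain is shrunk until the
  -- derivative is invertible at each of its points.
  have hinv : ∀ᶠ x in 𝓝 a, fderiv ℝ f x ∈ Set.range ((↑) : (E ≃L[ℝ] F) → E →L[ℝ] F) :=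
    hcont.eventually_mem (ContinuousLinearEquiv.isOpen.mem_nhds ⟨f', hf'.fderiv.symm⟩)
  obtain ⟨V, hV, hVo, haV⟩ := mem_nhds_iff.1 (Filter.inter_mem hU hinv)
  let e' := e.restrOpen V hVo
  have hsrc : e'.source = e.source ∩ V := e.restrOpen_source V hVo
  have hVat : ∀ x ∈ V, ContDiffAt ℝ ∞ f x := fun x hx =>
    hf.contDiffAt (Filter.mem_of_superset (hVo.mem_nhds hx) fun y hy => (hV hy).1)
  refine ⟨⟨e'.toPartialEquiv, e'.open_source, e'.open_target, ?_, ?_⟩, ?_, fun x _ => rfl⟩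
  · rw [contMDiffOn_iff_contDiffOn]
    intro x hx
    rw [hsrc] at hx
    exact (hVat x hx.2).contDiffWithinAt
  · rw [contMDiffOn_iff_contDiffOn]
    intro y hy
    have hx : e'.symm y ∈ e'.source := e'.map_target hy
    rw [hsrc] at hx
    obtain ⟨g', hg'⟩ := (hV hx.2).2
    refine (e'.contDiffAt_symm (f₀' := g') hy ?_ (hVat _ hx.2)).contDiffWithinAt
    rw [hg']
    exact ((hVat _ hx.2).differentiableAt (by simp)).hasFDerivAt
  · change a ∈ e'.source
    rw [hsrc]
    exact ⟨hea, haV⟩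

theorem isDiffeoGerm_of_hasFDerivAt_injective [FiniteDimensional ℝ E] {f : E → E} {a b : E}
    {U : Set E} (hU : U ∈ 𝓝 a) (hf : ContDiffOn ℝ ∞ f U) {f' : E →L[ℝ] E}
    (hf' : HasFDerivAt f f' a) (hinj : ∀ v, f' v = 0 → v = 0) (hb : f a = b) :
    IsDiffeoGerm f a b := by
  have := FiniteDimensional.complete ℝ E
  subst hb
  have hinj' : Function.Injective (f' : E →ₗ[ℝ] E) := (injective_iff_map_eq_zero _).2 hinj
  refine isDiffeoGerm_of_hasFDerivAt_equiv hU hf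
    (f' := (LinearEquiv.ofInjectiveEndo (f' : E →ₗ[ℝ] E) hinj').toContinuousLinearEquiv) ?_
  convert hf' using 1
  ext v
  rfl

theorem IsDiffeoGerm.comp {φ : E → F} {ψ : F → G} {p : E} {q : F} {r : G}
    (hψ : IsDiffeoGerm ψ q r) (hφ : IsDiffeoGerm φ p q) : IsDiffeoGerm (ψ ∘ φ) p r := by
  obtain ⟨hφ, rfl⟩ := hφ
  obtain ⟨hψ, rfl⟩ := hψ
  exact ⟨hφ.comp _ _ hψ, rfl⟩

theorem IsDiffeoGerm.exists_leftInverse {φ : E → F} {p : E} {q : F} (hφ : IsDiffeoGerm φ p q) :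
    ∃ ψ : F → E, IsDiffeoGerm ψ q p ∧ ψ ∘ φ =ᶠ[𝓝 p] id := by
  obtain ⟨hφ, rfl⟩ := hφ
  exact ⟨hφ.localInverse, ⟨hφ.localInverse_isLocalDiffeomorphAt,
    hφ.localInverse_left_inv hφ.localInverse_mem_target⟩, hφ.localInverse_eventuallyEq_left⟩

theorem IsDiffeoGerm.exists_contDiffOn {φ : E → F} {p : E} {q : F} (hφ : IsDiffeoGerm φ p q) :
    ∃ U ∈ 𝓝 p, ContDiffOn ℝ ∞ φ U := by
  obtain ⟨⟨Φ, hp, heq⟩, -⟩ := hφ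
  exact ⟨Φ.source, Φ.open_source.mem_nhds hp,
    (contMDiffOn_iff_contDiffOn.1 Φ.contMDiffOn_toFun).congr heq⟩

theorem IsDiffeoGerm.exists_hasFDerivAt_injective {φ : E → F} {p : E} {q : F}
    (hφ : IsDiffeoGerm φ p q) :
    ∃ A : E →L[ℝ] F, HasFDerivAt φ A p ∧ ∀ v, A v = 0 → v = 0 := by
  obtain ⟨ψ, hψ, hinv⟩ := hφ.exists_leftInverse
  obtain ⟨U, hU, hφU⟩ := hφ.exists_contDiffOn
  obtain ⟨V, hV, hψV⟩ := hψ.exists_contDiffOn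
  have hA := ((hφU.contDiffAt hU).differentiableAt (by simp)).hasFDerivAt
  have hB := ((hψV.contDiffAt hV).differentiableAt (by simp)).hasFDerivAt
  rw [← hφ.2] at hB
  have hid := (hB.comp p hA).unique ((hasFDerivAt_id p).congr_of_eventuallyEq hinv)
  refine ⟨_, hA, fun v hv => ?_⟩
  simpa [hv] using (DFunLike.congr_fun hid v).symm

/-- Composing with a diffeomorphism germ on the left does not change the `𝒜`-class. -/
theorem aEquivalentAt_diffeoGerm_comp_iff {E' F' : Type*}
    [NormedAddCommGroup E'] [NormedSpace ℝ E'] [NormedAddCommGroup F'] [NormedSpace ℝ F']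
    {P : F → G} {f : E → F} {p : E} {g : E' → F'} {p' : E'}
    (hP : IsDiffeoGerm P (f p) (P (f p))) (hf : ContinuousAt f p) :
    AEquivalentAt (P ∘ f) p g p' ↔ AEquivalentAt f p g p' := by
  constructor
  · rintro ⟨φ, Φ, hφ, hΦ, h⟩
    exact ⟨φ, Φ ∘ P, hφ, hΦ.comp hP, h⟩
  · rintro ⟨φ, Φ, hφ, hΦ, h⟩
    obtain ⟨Q, hQ, hQP⟩ := hP.exists_leftInverse
    refine ⟨φ, Φ ∘ Q, hφ, hΦ.comp hQ, ?_⟩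
    filter_upwards [h, hf.eventually hQP] with x hx hx'
    rw [← hx]
    exact congrArg Φ hx'

end DiffeoGerms

/-- Cylindrical coordinates `(θ, r, z) ↦ (r cos θ, r sin θ, z)`. -/
noncomputable def cylindricalCoord (w : ℝ × ℝ × ℝ) : ℝ × ℝ × ℝ :=
  (w.2.1 * Real.cos w.1, w.2.1 * Real.sin w.1, w.2.2)

theorem isDiffeoGerm_cylindricalCoord {w : ℝ × ℝ × ℝ} (hw : w.2.1 ≠ 0) :
    IsDiffeoGerm cylindricalCoord w (cylindricalCoord w) := by
  have hθ : HasFDerivAt (fun w : ℝ × ℝ × ℝ => w.1) (ContinuousLinearMap.fst ℝ ℝ (ℝ × ℝ)) w :=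
    hasFDerivAt_fst
  have hrz : HasFDerivAt (fun w : ℝ × ℝ × ℝ => w.2) (ContinuousLinearMap.snd ℝ ℝ (ℝ × ℝ)) w :=
    hasFDerivAt_snd
  have hd := (hrz.fst.mul hθ.cos).prodMk ((hrz.fst.mul hθ.sin).prodMk hrz.snd)
  have hsmooth : ContDiff ℝ ∞ cylindricalCoord := by
    unfold cylindricalCoord
    fun_prop
  refine isDiffeoGerm_of_hasFDerivAt_injective Filter.univ_mem hsmooth.contDiffOn hd ?_ rfl
  rintro ⟨a, b, c⟩ hv
  simp only [ContinuousLinearMap.prod_apply, Prod.mk_eq_zero, add_apply,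
    smul_apply, smul_eq_mul, ContinuousLinearMap.comp_apply,
    ContinuousLinearMap.coe_fst', ContinuousLinearMap.coe_snd'] at hv ⊢
  obtain ⟨h1, h2, rfl⟩ := hv
  have hcs := Real.sin_sq_add_cos_sq w.1
  -- Rotating the two horizontal equations by the angle -θ decouples them into b = 0 and r a = 0.
  have hb : b = 0 := by
    linear_combination Real.cos w.1 * h1 + Real.sin w.1 * h2 - b * hcs
  have ha : w.2.1 * a = 0 := by
    linear_combination Real.cos w.1 * h2 - Real.sin w.1 * h1 - w.2.1 * a * hcs
  exact ⟨(mul_eq_zero.1 ha).resolve_left hw, hb, rfl⟩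

/-- The trivial suspension of a cusp is a cuspidal edge. -/
theorem IsCuspAt.isCuspidalEdgeAt_suspension {i j : ℕ} {γ : ℝ → ℝ × ℝ} {t₀ : ℝ}
    (h : IsCuspAt i j γ t₀) (θ₀ : ℝ) :
    IsCuspidalEdgeAt i j (fun q => (q.2, γ q.1)) (t₀, θ₀) := by
  obtain ⟨φ, Φ, hφ, hΦ, heq⟩ := h
  obtain ⟨U, hU, hφU⟩ := hφ.exists_contDiffOn
  obtain ⟨V, hV, hΦV⟩ := hΦ.exists_contDiffOn
  obtain ⟨A, hA, hAinj⟩ := hφ.exists_hasFDerivAt_injective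
  obtain ⟨B, hB, hBinj⟩ := hΦ.exists_hasFDerivAt_injective
  refine ⟨fun q => (q.2 - θ₀, φ q.1), fun w => (w.1 - θ₀, Φ w.2), ?_, ?_, ?_⟩
  · refine isDiffeoGerm_of_hasFDerivAt_injective
      (prod_mem_nhds hU Filter.univ_mem) ?_
      ((hasFDerivAt_snd.sub_const θ₀).prodMk
        (HasFDerivAt.comp (t₀, θ₀) (f := Prod.fst) hA hasFDerivAt_fst)) ?_ ?_
    · exact (contDiff_snd.sub contDiff_const).contDiffOn.prodMk
        (hφU.comp contDiff_fst.contDiffOn fun q hq => hq.1)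
    · rintro ⟨a, b⟩ hv
      simp only [ContinuousLinearMap.prod_apply, Prod.mk_eq_zero,
        ContinuousLinearMap.comp_apply, ContinuousLinearMap.coe_fst',
        ContinuousLinearMap.coe_snd'] at hv ⊢
      exact ⟨hAinj _ hv.2, hv.1⟩
    · simp [hφ.2]
  · refine isDiffeoGerm_of_hasFDerivAt_injective
      (prod_mem_nhds Filter.univ_mem hV) ?_
      ((hasFDerivAt_fst.sub_const θ₀).prodMk
        (HasFDerivAt.comp (θ₀, γ t₀) (f := Prod.snd) hB hasFDerivAt_snd)) ?_ ?_
    · exact (contDiff_fst.sub contDiff_const).contDiffOn.prodMk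
        (hΦV.comp contDiff_snd.contDiffOn fun q hq => hq.2)
    · rintro ⟨a, b⟩ hv
      simp only [ContinuousLinearMap.prod_apply, Prod.mk_eq_zero,
        ContinuousLinearMap.comp_apply, ContinuousLinearMap.coe_fst',
        ContinuousLinearMap.coe_snd'] at hv
      exact Prod.mk_eq_zero.2 ⟨hv.1, hBinj _ hv.2⟩
    · simp [hΦ.2]
  · have hfst : Filter.Tendsto Prod.fst (𝓝 (t₀, θ₀)) (𝓝 t₀) := continuousAt_fst
    filter_upwards [hfst.eventually heq] with q hq
    exact Prod.ext rfl hq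

/-- Exponents at least 2 make both powers vanish to first order. -/
theorem hasFDerivAt_cuspidalEdge {i j : ℕ} (hi : 2 ≤ i) (hj : 2 ≤ j) :
    HasFDerivAt (fun q : ℝ × ℝ => (q.1, q.2 ^ i, q.2 ^ j))
      ((ContinuousLinearMap.fst ℝ ℝ ℝ).prod 0) (0, 0) := by
  have hpow : ∀ n : ℕ, 2 ≤ n →
      HasFDerivAt (fun q : ℝ × ℝ => q.2 ^ n) (0 : ℝ × ℝ →L[ℝ] ℝ) (0, 0) := by
    intro n hn
    have h := (hasFDerivAt_snd (𝕜 := ℝ) (p := ((0, 0) : ℝ × ℝ))).pow n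
    have h0 : (0 : ℝ) ^ (n - 1) = 0 := zero_pow (by omega)
    simpa only [h0, smul_zero, zero_smul] using h
  exact hasFDerivAt_fst.prodMk ((hpow i hi).prodMk (hpow j hj))

/-- A plane curve whose trivial suspension is a cuspidal edge is a cusp. -/
theorem IsCuspidalEdgeAt.isCuspAt_of_suspension {i j : ℕ} (hi : 2 ≤ i) (hj : 2 ≤ j)
    {γ : ℝ → ℝ × ℝ} {t₀ θ₀ : ℝ} (hγ : DifferentiableAt ℝ γ t₀)
    (h : IsCuspidalEdgeAt i j (fun q => (q.2, γ q.1)) (t₀, θ₀)) : IsCuspAt i j γ t₀ := by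
  obtain ⟨φ, Ψ, hφ, hΨ, heq⟩ := h
  obtain ⟨U, hU, hφU⟩ := hφ.exists_contDiffOn
  obtain ⟨V, hV, hΨV⟩ := hΨ.exists_contDiffOn
  obtain ⟨B, hB, hBinj⟩ := hφ.exists_hasFDerivAt_injective
  obtain ⟨A, hA, hAinj⟩ := hΨ.exists_hasFDerivAt_injective
  have hf : HasFDerivAt (fun q : ℝ × ℝ => (q.2, γ q.1)) _ (t₀, θ₀) :=
    hasFDerivAt_snd.prodMk
      (HasFDerivAt.comp (t₀, θ₀) (f := Prod.fst) hγ.hasFDerivAt hasFDerivAt_fst)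
  have hg := hasFDerivAt_cuspidalEdge hi hj
  -- Chain rule on both sides of the equivalence; the t and θ columns read A (0, γ') = (a, 0) and A
  -- (1, 0) = (b, 0).
  have hD := (hA.comp (t₀, θ₀) hf).unique
    ((HasFDerivAt.comp (t₀, θ₀) (hφ.2 ▸ hg) hB).congr_of_eventuallyEq heq)
  have hDt := DFunLike.congr_fun hD (1, 0)
  have hDθ := DFunLike.congr_fun hD (0, 1)
  simp only [ContinuousLinearMap.comp_apply, ContinuousLinearMap.prod_apply,
    ContinuousLinearMap.coe_fst', ContinuousLinearMap.coe_snd', zero_apply, map_zero] at hDt hDθ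
  set a := (B (1, 0)).1 with ha
  set b := (B (0, 1)).1 with hb
  have hb0 : b ≠ 0 := by
    intro h0
    rw [h0] at hDθ
    simpa using hAinj _ hDθ
  -- `A` maps the line spanned by `(1, 0)` onto the tangent line of the edge.
  have key : ∀ (w : ℝ × ℝ) (c : ℝ), A (0, w) = (c, 0) → c = 0 ∧ w = 0 := by
    intro w c hw
    have h0 : A (b • ((0 : ℝ), w) - c • ((1 : ℝ), (0 : ℝ × ℝ))) = 0 := by
      rw [map_sub, map_smul, map_smul, hw, hDθ]
      simp [mul_comm]
    have h1 := hAinj _ h0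
    simp only [Prod.smul_mk, Prod.mk_sub_mk, Prod.mk_eq_zero, smul_zero, smul_eq_mul, mul_one,
      mul_zero, zero_sub, neg_eq_zero, sub_zero] at h1
    exact ⟨h1.1, (smul_eq_zero.1 h1.2).resolve_left hb0⟩
  -- The derivative of `φ` thus sends the t-direction into the v-direction, so its v-component alone
  -- detects that direction.
  have ha0 : a = 0 := (key _ _ hDt).1
  refine ⟨fun t => (φ (t, θ₀)).2, fun y => (Ψ (θ₀, y)).2, ?_, ?_, ?_⟩
  · have hι : HasFDerivAt (fun t : ℝ => (t, θ₀)) (ContinuousLinearMap.inl ℝ ℝ ℝ) t₀ :=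
      hasFDerivAt_prodMk_left t₀ θ₀
    refine isDiffeoGerm_of_hasFDerivAt_injective (hι.continuousAt.preimage_mem_nhds hU) ?_
      (HasFDerivAt.comp t₀ (f := fun t : ℝ => (t, θ₀)) hB hι).snd ?_ ?_
    · exact (hφU.comp (contDiff_id.prodMk contDiff_const).contDiffOn fun t ht => ht).snd
    · intro v hv
      have hv' : (B (v, 0)).2 = 0 := hv
      have hsm : ((v, 0) : ℝ × ℝ) = v • ((1, 0) : ℝ × ℝ) := by simp
      have h1 : (B (v, 0)).1 = 0 := by rw [hsm, map_smul, Prod.smul_fst, ← ha, ha0, smul_zero]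
      exact (Prod.mk_eq_zero.1 (hBinj _ (Prod.ext h1 hv'))).1
    · simp [hφ.2]
  · have hι : HasFDerivAt (fun y : ℝ × ℝ => (θ₀, y)) (ContinuousLinearMap.inr ℝ ℝ (ℝ × ℝ)) (γ t₀) :=
      hasFDerivAt_prodMk_right θ₀ (γ t₀)
    refine isDiffeoGerm_of_hasFDerivAt_injective (hι.continuousAt.preimage_mem_nhds hV) ?_
      (HasFDerivAt.comp (γ t₀) (f := fun y : ℝ × ℝ => (θ₀, y)) hA hι).snd ?_ ?_
    · exact (hΨV.comp (contDiff_const.prodMk contDiff_id).contDiffOn fun t ht => ht).snd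
    · intro w hw
      have hw' : (A (0, w)).2 = 0 := hw
      exact (key w (A (0, w)).1 (Prod.ext rfl hw')).2
    · exact congrArg Prod.snd hΨ.2
  · have hι : Filter.Tendsto (fun t : ℝ => (t, θ₀)) (𝓝 t₀) (𝓝 (t₀, θ₀)) := by
      exact (Continuous.prodMk_left θ₀).continuousAt
    filter_upwards [hι.eventually heq] with t ht
    exact congrArg Prod.snd ht

theorem mainTheorem3 (i j : ℕ)
    (hij : (i, j) ∈ ({(2, 3), (2, 5), (3, 4), (3, 5)} : Set (ℕ × ℕ)))
    (I : Set ℝ) (t₀ : ℝ) (hI : I ∈ 𝓝 t₀)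
    (γ : ℝ → ℝ × ℝ) (hγ : ContDiffOn ℝ ∞ γ I) (hx : 0 < (γ t₀).1) (θ₀ : ℝ) :
    IsCuspAt i j γ t₀ ↔ IsCuspidalEdgeAt i j (surfaceOfRevolutionZ γ) (t₀, θ₀) := by
  have hd : DifferentiableAt ℝ γ t₀ := (hγ.contDiffAt hI).differentiableAt (by simp)
  have hij' : 2 ≤ i ∧ 2 ≤ j := by
    simp only [Set.mem_insert_iff, Set.mem_singleton_iff, Prod.mk.injEq] at hij
    omega
  have hcont : ContinuousAt (fun q : ℝ × ℝ => (q.2, γ q.1)) (t₀, θ₀) :=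
    continuousAt_snd.prodMk
      (ContinuousAt.comp (f := Prod.fst) (x := (t₀, θ₀)) hd.continuousAt continuousAt_fst)
  -- The surface is by definition `cylindricalCoord` after the suspension; x(t₀) > 0 keeps the base
  -- point off the axis.
  have hsusp : IsCuspidalEdgeAt i j (surfaceOfRevolutionZ γ) (t₀, θ₀) ↔
      IsCuspidalEdgeAt i j (fun q => (q.2, γ q.1)) (t₀, θ₀) :=
    aEquivalentAt_diffeoGerm_comp_iff (P := cylindricalCoord)
      (f := fun q : ℝ × ℝ => (q.2, γ q.1)) (isDiffeoGerm_cylindricalCoord hx.ne') hcont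
  rw [hsusp]
  exact ⟨fun h => h.isCuspidalEdgeAt_suspension θ₀,
    fun h => h.isCuspAt_of_suspension hij'.1 hij'.2 hd⟩
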